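/- Let $\zeta_k=e^{i(\pi/2+2\pi k/5)}$. Let $A$ be the regular pentagon in $\mathbb C$ with vertices $\zeta_0,\dots,\zeta_4$ (so that its bottom edge is horizontal), let $B=-A$, and let the *double pentagon* be the translation surface obtained from $A$ and $B$ by gluing opposite parallel edges by translations. Label the upper left, upper right, lower left, lower right and bottom edge of $A$ by $1,2,3,4,5$, and give each edge of $B$ the label of the edge of $A$ that it is glued to. The *cutting sequence* of an oriented bi-infinite linear trajectory that hits no corner is the bi-infinite sequence $(e_i)_{i\in\mathbb Z}$ of the labels of the edges that it crosses, and its *decorated cutting sequence* is the sequence of symbols $e_i^{\,e_{i+1}}$, with base $e_i$ and exponent $e_{i+1}$. For $k=0,1,2,3$ let $r_k$ be the following substitution on words in the symbols $1^2,2^1,2^3,3^2,3^4,4^3,4^5,5^4$: $$\begin{array}{c|llll} & r_0 & r_1 & r_2 & r_3\\ \hline 1^2 & 2^1 & 3^4\,4^5 & 4^3\,3^2 & 1^2\,2^3\\ 2^1 & 1^2 & 5^4\,4^3 & 2^3\,3^4 & 3^2\,2^1\\ 2^3 & 1^2\,2^3\,3^4 & 5^4\,4^3\,3^2\,2^1 &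 2^3\,3^4\,4^5 & 3^2\\ 3^2 & 4^3\,3^2\,2^1 & 1^2\,2^3\,3^4\,4^5 & 5^4\,4^3\,3^2 & 2^3\\ 3^4 & 4^3 & 1^2\,2^3\,3^4 & 5^4\,4^3\,3^2\,2^1 & 2^3\,3^4\,4^5\\ 4^3 & 3^4 & 4^3\,3^2\,2^1 & 1^2\,2^3\,3^4\,4^5 & 5^4\,4^3\,3^2\\ 4^5 & 3^4\,4^5 & 4^3\,3^2 & 1^2\,2^3 & 5^4\\ 5^4 & 5^4\,4^3 & 2^3\,3^4 & 3^2\,2^1 & 4^5 \end{array}$$ Say that a finite word $w$ of symbols has the *palindrome properties* if it reads the same in the reverse order 1. when the base and exponent of every symbol are reversed (if $w=a_1^{b_1}\cdots a_n^{b_n}$, then $b_n^{a_n}\cdots b_1^{a_1}=w$); 2. when bases and exponents are treated the same (the sequence $a_1b_1a_2b_2\cdots a_nb_n$ is a palindrome); 3. when the exponents are ignored and the first digit is removed (the sequence $a_2a_3\cdots a_n$ is a palindrome). Let $\tau$ be an oriented bi-infinite linear trajectory on the double pentagon whose cutting sequence is periodic, and let $n\ge 1$ be any period of the cutting sequence.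 Then: * (a) Every block of $n$ consecutive symbols of the decorated cutting sequence of $\tau$ satisfies 1 and 2 up to a cyclic rotation (of the word in 1, of the sequence of digits in 2), and some such block has the palindrome properties 1, 2 and 3. * (b) If the direction of $\tau$ makes an angle $\theta\in[0,\pi/5)$ with the positive horizontal axis, then the decorated cutting sequence of $\tau$ is the bi-infinite repetition of some word $r_{k_1}(\cdots r_{k_j}(s)\cdots)$ with $j\ge 0$, $k_1,\dots,k_j\in\{0,1,2,3\}$ and $s\in\{1^2\,2^1,\;3^4\,4^3\}$. Whenever the decorated cutting sequence is the bi-infinite repetition of a word of this form, this word has the palindrome properties 1, 2 and 3, and so does the block of $n$ consecutive symbols that starts at the same place (at the beginning of an occurrence of the word in the repetition). -/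

import Mathlib

/-!
# Cutting sequences on the double pentagon

The double pentagon surface, its linear trajectories, their (decorated) cutting sequences,
the four substitutions on decorated sequences, and the three palindrome properties.
-/

namespace DoublePentagon

/-- The five edge labels of the double pentagon. -/
inductive EdgeLabel
  | e1 | e2 | e3 | e4 | e5

/-- The two regular pentagons of the surface: one with its apex up, and its image under `z ↦ -z`. -/
inductive Face
  | up | down

/-- The other pentagon. -/
def Face.other : Face → Face
  | .up => .down
  | .down => .up

/-- The vertices of the upward pointing regular pentagon, inscribed in the unit circle, in
counterclockwise order; `vertex 0` is the apex, and `vertex 2`, `vertex 3` span the horizontal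
bottom edge. -/
noncomputable def vertex (k : ℕ) : ℂ :=
  Complex.exp (((Real.pi / 2 + 2 * Real.pi * k / 5 : ℝ) : ℂ) * Complex.I)

/-- The initial vertex (counterclockwise) of the edge of the upward pentagon with a given label:
`1` is the upper left edge, `2` the upper right, `3` the lower left, `4` the lower right and
`5` the bottom edge. -/
noncomputable def edgeStart : EdgeLabel → ℂ
  | .e1 => vertex 0
  | .e2 => vertex 4
  | .e3 => vertex 1
  | .e4 => vertex 3
  | .e5 => vertex 2

/-- The terminal vertex (counterclockwise) of the edge of the upward pentagon with a given
label. -/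
noncomputable def edgeEnd : EdgeLabel → ℂ
  | .e1 => vertex 1
  | .e2 => vertex 0
  | .e3 => vertex 2
  | .e4 => vertex 4
  | .e5 => vertex 3

/-- The edge with label `l` of a pentagon, without its end points. The edge of the downward
pentagon with label `l` is opposite and parallel to the one of the upward pentagon. -/
def openEdge : Face → EdgeLabel → Set ℂ
  | .up, l => openSegment ℝ (edgeStart l) (edgeEnd l)
  | .down, l => openSegment ℝ (-edgeStart l) (-edgeEnd l)

/-- The translation that glues the edge `l` of the given pentagon to the parallel edge `l` of the
other pentagon. -/
noncomputable def gluing : Face → EdgeLabel → ℂ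
  | .up, l => -(edgeStart l + edgeEnd l)
  | .down, l => edgeStart l + edgeEnd l

/-- An oriented bi-infinite linear trajectory on the double pentagon which hits no corner, cut
at its crossings of the edges. Its `i`-th piece is a straight chord in direction `dir` of the
pentagon `face i`, from the point `entry i` inside the edge `label i` to the point `exit i` inside
another edge, the edge `label (i + 1)`; there the trajectory passes through the gluing into
the other pentagon, and goes on in the same direction. -/
structure LinearTrajectory where
  dir : ℂ
  dir_ne_zero : dir ≠ 0
  label : ℤ → EdgeLabel
  face : ℤ → Face
  entry : ℤ → ℂ
  exit : ℤ → ℂ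
  entry_mem : ∀ i, entry i ∈ openEdge (face i) (label i)
  exit_mem : ∀ i, exit i ∈ openEdge (face i) (label (i + 1))
  label_ne : ∀ i, label i ≠ label (i + 1)
  straight : ∀ i, ∃ s : ℝ, 0 < s ∧ exit i - entry i = (s : ℂ) * dir
  face_succ : ∀ i, face (i + 1) = (face i).other
  entry_succ : ∀ i, entry (i + 1) = exit i + gluing (face i) (label (i + 1))

/-- The cutting sequence of a trajectory: the labels of the edges that it crosses, in order. -/
def LinearTrajectory.cuttingSequence (τ : LinearTrajectory) : ℤ → EdgeLabel := τ.label

/-- A symbol `a^b` of a decorated cutting sequence, that is, the arrow from `a` to `b`. -/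
structure DecoratedSymbol where
  base : EdgeLabel
  exponent : EdgeLabel

/-- The symbol with base and exponent reversed. -/
def DecoratedSymbol.swap (x : DecoratedSymbol) : DecoratedSymbol := ⟨x.exponent, x.base⟩

/-- The decorated cutting sequence: every symbol carries the next one as its exponent. -/
def LinearTrajectory.decorated (τ : LinearTrajectory) (i : ℤ) : DecoratedSymbol :=
  ⟨τ.cuttingSequence i, τ.cuttingSequence (i + 1)⟩

/-- The `n` consecutive symbols of the decorated cutting sequence that start at index `m`. -/
def LinearTrajectory.block (τ : LinearTrajectory) (m : ℤ) (n : ℕ) : List DecoratedSymbol :=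
  List.ofFn fun j : Fin n => τ.decorated (m + (j : ℕ))

/-- The decorated cutting sequence, read from index `m` on, is the two-sided infinite repetition
of the word `w`. -/
def LinearTrajectory.ReadsAs (τ : LinearTrajectory) (m : ℤ) (w : List DecoratedSymbol) : Prop :=
  w ≠ [] ∧ ∀ (k : ℤ) (j : ℕ) (hj : j < w.length), τ.decorated (m + k * w.length + j) = w[j]

namespace Symbols

/-- The arrow symbols of the transition diagram `1 ⇄ 2 ⇄ 3 ⇄ 4 ⇄ 5`. -/
abbrev s12 : DecoratedSymbol := ⟨.e1, .e2⟩
abbrev s21 : DecoratedSymbol := ⟨.e2, .e1⟩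
abbrev s23 : DecoratedSymbol := ⟨.e2, .e3⟩
abbrev s32 : DecoratedSymbol := ⟨.e3, .e2⟩
abbrev s34 : DecoratedSymbol := ⟨.e3, .e4⟩
abbrev s43 : DecoratedSymbol := ⟨.e4, .e3⟩
abbrev s45 : DecoratedSymbol := ⟨.e4, .e5⟩
abbrev s54 : DecoratedSymbol := ⟨.e5, .e4⟩

end Symbols

open Symbols in
/-- The substitution rules `r₀, r₁, r₂, r₃` on single symbols. Pairs that are not arrows of the
transition diagram never occur in the words below; they are left fixed. -/
def rule : Fin 4 → DecoratedSymbol → List DecoratedSymbol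
  | 0, ⟨.e1, .e2⟩ => [s21]
  | 0, ⟨.e2, .e1⟩ => [s12]
  | 0, ⟨.e2, .e3⟩ => [s12, s23, s34]
  | 0, ⟨.e3, .e2⟩ => [s43, s32, s21]
  | 0, ⟨.e3, .e4⟩ => [s43]
  | 0, ⟨.e4, .e3⟩ => [s34]
  | 0, ⟨.e4, .e5⟩ => [s34, s45]
  | 0, ⟨.e5, .e4⟩ => [s54, s43]
  | 1, ⟨.e1, .e2⟩ => [s34, s45]
  | 1, ⟨.e2, .e1⟩ => [s54, s43]
  | 1, ⟨.e2, .e3⟩ => [s54, s43, s32, s21]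
  | 1, ⟨.e3, .e2⟩ => [s12, s23, s34, s45]
  | 1, ⟨.e3, .e4⟩ => [s12, s23, s34]
  | 1, ⟨.e4, .e3⟩ => [s43, s32, s21]
  | 1, ⟨.e4, .e5⟩ => [s43, s32]
  | 1, ⟨.e5, .e4⟩ => [s23, s34]
  | 2, ⟨.e1, .e2⟩ => [s43, s32]
  | 2, ⟨.e2, .e1⟩ => [s23, s34]
  | 2, ⟨.e2, .e3⟩ => [s23, s34, s45]
  | 2, ⟨.e3, .e2⟩ => [s54, s43, s32]
  | 2, ⟨.e3, .e4⟩ => [s54, s43, s32, s21]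
  | 2, ⟨.e4, .e3⟩ => [s12, s23, s34, s45]
  | 2, ⟨.e4, .e5⟩ => [s12, s23]
  | 2, ⟨.e5, .e4⟩ => [s32, s21]
  | 3, ⟨.e1, .e2⟩ => [s12, s23]
  | 3, ⟨.e2, .e1⟩ => [s32, s21]
  | 3, ⟨.e2, .e3⟩ => [s32]
  | 3, ⟨.e3, .e2⟩ => [s23]
  | 3, ⟨.e3, .e4⟩ => [s23, s34, s45]
  | 3, ⟨.e4, .e3⟩ => [s54, s43, s32]
  | 3, ⟨.e4, .e5⟩ => [s54]
  | 3, ⟨.e5, .e4⟩ => [s45]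
  | _, x => [x]

/-- The substitution `r_k` on words, symbol by symbol. -/
def substitute (k : Fin 4) (w : List DecoratedSymbol) : List DecoratedSymbol :=
  w.flatMap (rule k)

/-- `applyRules [k₀, …, kₙ] w = r_{k₀} (⋯ (r_{kₙ} w))`. -/
def applyRules (ks : List (Fin 4)) (w : List DecoratedSymbol) : List DecoratedSymbol :=
  ks.foldr substitute w

/-- The two starting words `1² 2¹` (short trajectories) and `3⁴ 4³` (long trajectories). -/
def startingWords : Set (List DecoratedSymbol) :=
  {[Symbols.s12, Symbols.s21], [Symbols.s34, Symbols.s43]}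

/-- The word obtained by reading `w` backwards, with the base and exponent of every symbol
reversed. -/
def reverseSwap (w : List DecoratedSymbol) : List DecoratedSymbol :=
  w.reverse.map DecoratedSymbol.swap

/-- All bases and exponents of `w`, treated alike, in the order in which they are written. -/
def flatten (w : List DecoratedSymbol) : List EdgeLabel :=
  w.flatMap fun x => [x.base, x.exponent]

/-- The bases of `w`, with the exponents ignored. -/
def bases (w : List DecoratedSymbol) : List EdgeLabel :=
  w.map DecoratedSymbol.base

/-- The three palindrome properties of a word: it reads the same in the reverse order if base and
exponent are reversed; if bases and exponents are treated the same; if the exponents are ignored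
and the first digit is removed. -/
structure PalindromeProperties (w : List DecoratedSymbol) : Prop where
  reverse_swap : reverseSwap w = w
  reverse_flatten : (flatten w).reverse = flatten w
  reverse_tail_bases : (bases w).tail.reverse = (bases w).tail

end DoublePentagon

/-! Everything is derived from one centre of symmetry: an index `m` with `label (m + i) = label (m -
i)` for all `i`. Such a centre together with any period gives all three palindrome properties
(`SymmetricAt.palindromeProperties`).

For directions in the sector, a crossing is recorded by its edge and its transverse offset from the
edge's midpoint. The step from one edge to the next is then a translation fixed by the two labels.
Each `r_k` comes from an affine automorphism that permutes edge midpoints. Crossings close enough to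
a midpoint are also crossings of the image edges, and between two successive ones the trajectory
spells exactly one `rule k` word (`Path.first_chunk`), so it can be desubstituted.

A periodic cutting sequence gives a closed path (`offset_add_period`). If its direction is not
horizontal, desubstitution shortens it, so the descent ends at a horizontal path, which repeats `1²
2¹` or `3⁴ 4³` (`Path.exists_isRotated`). Both words are fixed by reversal with swap, and this
reversal commutes with every substitution because it does so on the table (`reverseSwap_rule`).
Hence every generated word is fixed, and its starting place is a centre of symmetry. Other
directions are brought into the sector by rotations through `π / 5`, which only relabel the edges.
-/

namespace DoublePentagon

open EdgeLabel Symbols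

/-! ### Symbolic trajectories in transverse coordinates. -/

/-- The transverse width of the edge with a given label, for the direction whose transverse
measures of the edges `1` and `5` are `a` and `b`. -/
noncomputable def width (a b : ℝ) : EdgeLabel → ℝ
  | e1 => a
  | e2 => a + Real.goldenRatio * b
  | e3 => Real.goldenRatio * (a + b)
  | e4 => Real.goldenRatio * a + b
  | e5 => b

/-- `Crosses a b x t y t'`: a trajectory that crosses the edge `x` at the (doubled) transverse
offset `t` from its midpoint crosses next the edge `y`, at offset `t'` from the midpoint. -/
def Crosses (a b : ℝ) : EdgeLabel → ℝ → EdgeLabel → ℝ → Prop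
  | e1, t, e2, t' | e2, t, e1, t' => t' = t - Real.goldenRatio * b
  | e2, t, e3, t' | e3, t, e2, t' => t' = t + (Real.goldenRatio + 1) * a
  | e3, t, e4, t' | e4, t, e3, t' => t' = t - (Real.goldenRatio + 1) * b
  | e4, t, e5, t' | e5, t, e4, t' => t' = t + Real.goldenRatio * a
  | _, _, _, _ => False

/-- A finite piece of a trajectory: its first crossing, its decorated cutting word and its last
crossing. -/
inductive Path (a b : ℝ) : EdgeLabel → ℝ → List DecoratedSymbol → EdgeLabel → ℝ → Prop
  | nil {x : EdgeLabel} {t : ℝ} (h : |t| < width a b x) : Path a b x t [] x t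
  | cons {x y z : EdgeLabel} {t t' t'' : ℝ} {w : List DecoratedSymbol}
      (h : |t| < width a b x) (hs : Crosses a b x t y t') (hp : Path a b y t' w z t'') :
      Path a b x t (⟨x, y⟩ :: w) z t''

namespace Path

variable {a b t t' t'' : ℝ} {x y z : EdgeLabel} {w w' : List DecoratedSymbol}

theorem abs_lt_width (h : Path a b x t w z t'') : |t| < width a b x := by
  cases h <;> assumption

theorem append (h : Path a b x t w y t') (h' : Path a b y t' w' z t'') :
    Path a b x t (w ++ w') z t'' := by
  induction h with
  | nil => exact h'
  | cons h hs _ ih => exact .cons h hs (ih h')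

theorem inv (h : Path a b x t w z t'') : (w = [] ∧ z = x ∧ t'' = t) ∨
    ∃ y t' w', w = ⟨x, y⟩ :: w' ∧ Crosses a b x t y t' ∧ Path a b y t' w' z t'' := by
  cases h with
  | nil => exact .inl ⟨rfl, rfl, rfl⟩
  | cons _ hs hp => exact .inr ⟨_, _, _, rfl, hs, hp⟩

end Path

/-! ### The four renormalizations. -/

/-- The action of `r_k` on directions, in the coordinates given by the widths of the edges `1`
and `5`: the first coordinate. -/
noncomputable def inflateFst (k : Fin 4) (a b : ℝ) : ℝ :=
  match k with
  | 0 => a + Real.goldenRatio * b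
  | 1 => Real.goldenRatio * (a + b)
  | 2 => Real.goldenRatio * a + b
  | 3 => a

/-- The action of `r_k` on directions: the second coordinate. -/
noncomputable def inflateSnd (k : Fin 4) (a b : ℝ) : ℝ :=
  match k with
  | 0 => b
  | 1 => a + Real.goldenRatio * b
  | 2 => Real.goldenRatio * (a + b)
  | 3 => Real.goldenRatio * a + b

/-- The affine automorphism behind `r_k` takes the midpoint of one edge to the midpoint of
another: `pullLabel k z` is the edge whose midpoint is taken to the midpoint of the edge `z`. -/
def pullLabel : Fin 4 → EdgeLabel → EdgeLabel
  | 0, e1 => e2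
  | 0, e2 => e1
  | 0, e3 => e4
  | 0, e4 => e3
  | 0, e5 => e5
  | 1, e1 => e3
  | 1, e2 => e5
  | 1, e3 => e1
  | 1, e4 => e4
  | 1, e5 => e2
  | 2, e1 => e4
  | 2, e2 => e2
  | 2, e3 => e5
  | 2, e4 => e1
  | 2, e5 => e3
  | 3, e1 => e1
  | 3, e2 => e3
  | 3, e3 => e2
  | 3, e4 => e5
  | 3, e5 => e4

/-- Once `φ²` is reduced, the case checks are linear in `a`, `b`, `φ a`, `φ b`, and the bounds `3/2
< φ < 5/3` are sharp enough for `linarith` to decide them. -/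
theorem golden_sq_mul (c : ℝ) : Real.goldenRatio ^ 2 * c = Real.goldenRatio * c + c := by
  rw [Real.goldenRatio_sq]; ring

theorem golden_gt : (3 / 2 : ℝ) < Real.goldenRatio := by
  have := Real.goldenRatio_sq
  have := Real.goldenRatio_pos
  nlinarith

theorem golden_lt : Real.goldenRatio < 5 / 3 := by
  have := Real.goldenRatio_sq
  have := Real.goldenRatio_pos
  nlinarith

/-! ### Desubstitution between marked crossings. -/

/-- A crossing of the inflated system lies on an edge of the original one, seen through the affine
automorphism. -/
def Marked (k : Fin 4) (a b : ℝ) (z : EdgeLabel) (t : ℝ) : Prop :=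
  |t| < width a b (pullLabel k z)

/-- A path that ends at a marked crossing cannot stop at an unmarked one. This drives the case tree
of `Path.first_chunk`. -/
theorem Path.marked_or_cons {k : Fin 4} {a b a' b' : ℝ} {x z : EdgeLabel} {t t'' : ℝ}
    {w : List DecoratedSymbol} (h : Path a' b' x t w z t'') (hz : Marked k a b z t'') :
    Marked k a b x t ∨ (t ≤ -width a b (pullLabel k x) ∨ width a b (pullLabel k x) ≤ t) ∧
      ∃ y t' w', w = ⟨x, y⟩ :: w' ∧ Crosses a' b' x t y t' ∧ Path a' b' y t' w' z t'' := by
  by_cases hm : Marked k a b x t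
  · exact .inl hm
  rcases h.inv with ⟨rfl, rfl, rfl⟩ | h
  · exact absurd hz hm
  · refine .inr ⟨?_, h⟩
    rw [Marked, abs_lt, not_and_or, not_lt, not_lt] at hm
    exact hm

-- An edge and the image edge sharing its midpoint have the same offset coordinate, so one step of
-- the original system runs from a marked crossing to the next. The proof follows all possible label
-- sequences; widths exclude the impossible ones, and the rest match the table.
set_option maxHeartbeats 4000000 in
theorem Path.first_chunk {k : Fin 4} {a b : ℝ} (ha : 0 ≤ a) (hb : 0 ≤ b)
    {x z : EdgeLabel} {t t'' : ℝ} {w : List DecoratedSymbol}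
    (h : Path (inflateFst k a b) (inflateSnd k a b) x t w z t'')
    (hx : Marked k a b x t) (hz : Marked k a b z t'') (hw : w ≠ []) :
    ∃ y t' w', Path (inflateFst k a b) (inflateSnd k a b) y t' w' z t'' ∧
      w = rule k ⟨pullLabel k x, pullLabel k y⟩ ++ w' ∧ Marked k a b y t' ∧
      Crosses a b (pullLabel k x) t (pullLabel k y) t' := by
  have hA := golden_sq_mul a
  have hB := golden_sq_mul b
  have hA1 := mul_le_mul_of_nonneg_right golden_gt.le ha
  have hA2 := mul_le_mul_of_nonneg_right golden_lt.le ha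
  have hB1 := mul_le_mul_of_nonneg_right golden_gt.le hb
  have hB2 := mul_le_mul_of_nonneg_right golden_lt.le hb
  have hx1 := (abs_lt.1 hx).1
  have hx2 := (abs_lt.1 hx).2
  rcases h.inv with ⟨rfl, rfl, rfl⟩ | ⟨y, t1, w, rfl, hs, h⟩
  · exact absurd rfl hw
  clear hx hw
  fin_cases k <;> cases x <;> cases y <;> cases hs
  all_goals
    simp only [pullLabel, inflateFst, inflateSnd, width] at h hx1 hx2
    have l1 := (abs_lt.1 h.abs_lt_width).1
    have u1 := (abs_lt.1 h.abs_lt_width).2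
    simp only [width] at l1 u1
    first
    | (exfalso; linarith)
    | rcases h.marked_or_cons hz with hm | ⟨hm, y, t', w, rfl, hs, h⟩
      · have hm' := abs_lt.1 hm
        simp only [pullLabel, width] at hm'
        first
        | (exfalso; linarith)
        -- Here `rfl` compares the symbols read since the last marked crossing with the entry of
        -- `rule`.
        | exact ⟨_, _, _, h, rfl, hm, by simp only [pullLabel, Crosses]⟩
      simp only [pullLabel, width] at hm
      rcases hm with hm1 | hm1 <;> cases y <;> cases hs
      all_goals
        have l2 := (abs_lt.1 h.abs_lt_width).1
        have u2 := (abs_lt.1 h.abs_lt_width).2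
        simp only [width] at l2 u2
        first
        | (exfalso; linarith)
        | rcases h.marked_or_cons hz with hm | ⟨hm, y, t', w, rfl, hs, h⟩
          · have hm' := abs_lt.1 hm
            simp only [pullLabel, width] at hm'
            first
            | (exfalso; linarith)
            | exact ⟨_, _, _, h, rfl, hm, by simp only [pullLabel, Crosses]; linarith⟩
          simp only [pullLabel, width] at hm
          rcases hm with hm2 | hm2 <;> cases y <;> cases hs
          all_goals
            have l3 := (abs_lt.1 h.abs_lt_width).1
            have u3 := (abs_lt.1 h.abs_lt_width).2
            simp only [width] at l3 u3
            first
            | (exfalso; linarith)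
            | rcases h.marked_or_cons hz with hm | ⟨hm, y, t', w, rfl, hs, h⟩
              · have hm' := abs_lt.1 hm
                simp only [pullLabel, width] at hm'
                first
                | (exfalso; linarith)
                | exact ⟨_, _, _, h, rfl, hm, by simp only [pullLabel, Crosses]; linarith⟩
              simp only [pullLabel, width] at hm
              rcases hm with hm3 | hm3 <;> cases y <;> cases hs
              all_goals
                have l4 := (abs_lt.1 h.abs_lt_width).1
                have u4 := (abs_lt.1 h.abs_lt_width).2
                simp only [width] at l4 u4
                first
                | (exfalso; linarith)
                -- After three unmarked crossings the fourth is forced to be marked: no entry of the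
                -- table has more than four symbols.
                | exact ⟨_, _, _, h, rfl, abs_lt.2 ⟨by simp only [pullLabel, width]; linarith,
                    by simp only [pullLabel, width]; linarith⟩,
                    by simp only [pullLabel, Crosses]; linarith⟩

/-- A path meets a marked crossing. -/
def MeetsMarked (k : Fin 4) (a b a' b' : ℝ) (x : EdgeLabel) (t : ℝ) (w : List DecoratedSymbol)
    (z : EdgeLabel) (t'' : ℝ) : Prop :=
  ∃ w₁ w₂ y t', w = w₁ ++ w₂ ∧ Path a' b' x t w₁ y t' ∧ Marked k a b y t' ∧
    Path a' b' y t' w₂ z t''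

theorem MeetsMarked.cons {k : Fin 4} {a b a' b' : ℝ} {x y z : EdgeLabel} {t t' t'' : ℝ}
    {w : List DecoratedSymbol} (h : |t| < width a' b' x) (hs : Crosses a' b' x t y t')
    (hm : MeetsMarked k a b a' b' y t' w z t'') :
    MeetsMarked k a b a' b' x t (⟨x, y⟩ :: w) z t'' := by
  obtain ⟨w₁, w₂, u, t₁, rfl, h₁, hu, h₂⟩ := hm
  exact ⟨_, w₂, u, t₁, rfl, .cons h hs h₁, hu, h₂⟩

theorem Path.meetsMarked_or {k : Fin 4} {a b a' b' : ℝ} {x z : EdgeLabel} {t t'' : ℝ}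
    {w : List DecoratedSymbol} (h : Path a' b' x t w z t'') :
    MeetsMarked k a b a' b' x t w z t'' ∨
      (t ≤ -width a b (pullLabel k x) ∨ width a b (pullLabel k x) ≤ t) := by
  by_cases hm : Marked k a b x t
  · exact .inl ⟨[], w, x, t, rfl, .nil h.abs_lt_width, hm, h⟩
  · rw [Marked, abs_lt, not_and_or, not_lt, not_lt] at hm
    exact .inr hm

-- Three symbols mean four crossings, and four consecutive unmarked crossings contradict the widths.
-- This provides a place to cut a closed path before desubstituting it.
set_option maxHeartbeats 4000000 in
theorem Path.meetsMarked {k : Fin 4} {a b : ℝ} (ha : 0 ≤ a) (hb : 0 ≤ b)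
    {x z : EdgeLabel} {t t'' : ℝ} {w : List DecoratedSymbol}
    (h : Path (inflateFst k a b) (inflateSnd k a b) x t w z t'') (hw : 3 ≤ w.length) :
    MeetsMarked k a b (inflateFst k a b) (inflateSnd k a b) x t w z t'' := by
  have hA := golden_sq_mul a
  have hB := golden_sq_mul b
  have hA1 := mul_le_mul_of_nonneg_right golden_gt.le ha
  have hA2 := mul_le_mul_of_nonneg_right golden_lt.le ha
  have hB1 := mul_le_mul_of_nonneg_right golden_gt.le hb
  have hB2 := mul_le_mul_of_nonneg_right golden_lt.le hb
  fin_cases k <;> cases x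
  all_goals
    have l0 := (abs_lt.1 h.abs_lt_width).1
    have u0 := (abs_lt.1 h.abs_lt_width).2
    simp only [inflateFst, inflateSnd] at h ⊢
    simp only [width, inflateFst, inflateSnd] at l0 u0
    refine (h.meetsMarked_or).elim id fun hm => ?_
    simp only [pullLabel, width] at hm
    rcases h.inv with ⟨rfl, rfl, rfl⟩ | ⟨y, t1, w, rfl, hs, h1⟩
    · simp at hw
    refine .cons h.abs_lt_width hs ?_
    rcases hm with hm | hm <;> cases y <;> cases hs
    all_goals
      have l1 := (abs_lt.1 h1.abs_lt_width).1
      have u1 := (abs_lt.1 h1.abs_lt_width).2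
      simp only [width] at l1 u1
      first
      | (exfalso; linarith)
      | refine (h1.meetsMarked_or).elim id fun hm1 => ?_
        simp only [pullLabel, width] at hm1
        rcases h1.inv with ⟨rfl, rfl, rfl⟩ | ⟨y, t1, w, rfl, hs, h2⟩
        · simp at hw
        refine .cons h1.abs_lt_width hs ?_
        rcases hm1 with hm1 | hm1 <;> cases y <;> cases hs
        all_goals
          have l2 := (abs_lt.1 h2.abs_lt_width).1
          have u2 := (abs_lt.1 h2.abs_lt_width).2
          simp only [width] at l2 u2
          first
          | (exfalso; linarith)
          | refine (h2.meetsMarked_or).elim id fun hm2 => ?_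
            simp only [pullLabel, width] at hm2
            rcases h2.inv with ⟨rfl, rfl, rfl⟩ | ⟨y, t1, w, rfl, hs, h3⟩
            · simp at hw
            refine .cons h2.abs_lt_width hs ?_
            rcases hm2 with hm2 | hm2 <;> cases y <;> cases hs
            all_goals
              have l3 := (abs_lt.1 h3.abs_lt_width).1
              have u3 := (abs_lt.1 h3.abs_lt_width).2
              simp only [width] at l3 u3
              first
              | (exfalso; linarith)
              | refine (h3.meetsMarked_or).elim id fun hm3 => ?_
                simp only [pullLabel, width] at hm3
                rcases hm3 with hm3 | hm3 <;> exfalso <;> linarith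

theorem rule_ne_nil (k : Fin 4) (s : DecoratedSymbol) : rule k s ≠ [] := by
  obtain ⟨x, y⟩ := s
  fin_cases k <;> cases x <;> cases y <;> simp [rule]

theorem Path.desubstitute {k : Fin 4} {a b : ℝ} (ha : 0 ≤ a) (hb : 0 ≤ b)
    {x z : EdgeLabel} {t t'' : ℝ} {w : List DecoratedSymbol}
    (h : Path (inflateFst k a b) (inflateSnd k a b) x t w z t'')
    (hx : Marked k a b x t) (hz : Marked k a b z t'') :
    ∃ v, w = substitute k v ∧ Path a b (pullLabel k x) t v (pullLabel k z) t'' := by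
  induction hn : w.length using Nat.strong_induction_on generalizing x t w with
  | _ n ih =>
    by_cases hw : w = []
    · subst hw
      cases h
      exact ⟨[], rfl, .nil hx⟩
    · obtain ⟨y, t', w', h', rfl, hy, hs⟩ := h.first_chunk ha hb hx hz hw
      have hlt : w'.length < n := by
        have := List.length_pos_of_ne_nil (rule_ne_nil k ⟨pullLabel k x, pullLabel k y⟩)
        rw [List.length_append] at hn
        omega
      obtain ⟨v, rfl, hv⟩ := ih _ hlt h' hy rfl
      exact ⟨_ :: v, rfl, .cons hx hs hv⟩

/-! ### Strict decrease of the length. -/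

/-- One step changes the label, and two steps returning to the same label repeat the same nonzero
shift. -/
theorem Path.three_le_length {a b : ℝ} (ha : 0 < a) (hb : 0 < b) {x : EdgeLabel} {t : ℝ}
    {w : List DecoratedSymbol} (h : Path a b x t w x t) (hw : w ≠ []) : 3 ≤ w.length := by
  have hg := Real.goldenRatio_pos
  have := mul_pos hg ha
  have := mul_pos hg hb
  rcases h.inv with ⟨rfl, -, -⟩ | ⟨y, t₁, w, rfl, hs, h⟩
  · exact absurd rfl hw
  rcases h.inv with ⟨rfl, rfl, rfl⟩ | ⟨z, t₂, w, rfl, hs', h⟩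
  · cases x <;> cases hs
  rcases h.inv with ⟨rfl, rfl, rfl⟩ | ⟨z, t₂, w, rfl, -, -⟩
  · exfalso
    cases x <;> cases y <;> simp only [Crosses] at hs hs' <;> linarith
  · simp

/-- The arrows that `r_0` does not lengthen are those between `1` and `2` and between `3` and `4`;
all of them lower the offset, so a path using only these cannot close up when `b > 0`. -/
theorem Path.le_of_length_rule_zero {a b : ℝ} (hb : 0 ≤ b) {x z : EdgeLabel} {t t'' : ℝ}
    {w : List DecoratedSymbol} (h : Path a b x t w z t'')
    (hw : ∀ s ∈ w, (rule 0 s).length ≤ 1) : t'' ≤ t - w.length * (Real.goldenRatio * b) := by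
  induction h with
  | nil => simp
  | @cons x y z t t' t'' w _ hs _ ih =>
    have h1 := ih fun s hs => hw s (List.mem_cons_of_mem _ hs)
    have h2 := hw _ List.mem_cons_self
    rw [List.length_cons]
    push_cast
    cases x <;> cases y <;> simp only [Crosses] at hs <;> simp [rule] at h2 <;> linarith

/-- The arrows that `r_3` does not lengthen, between `2` and `3` and between `4` and `5`, all raise
the offset. -/
theorem Path.le_of_length_rule_three {a b : ℝ} (ha : 0 ≤ a) {x z : EdgeLabel} {t t'' : ℝ}
    {w : List DecoratedSymbol} (h : Path a b x t w z t'')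
    (hw : ∀ s ∈ w, (rule 3 s).length ≤ 1) : t + w.length * (Real.goldenRatio * a) ≤ t'' := by
  induction h with
  | nil => simp
  | @cons x y z t t' t'' w _ hs _ ih =>
    have h1 := ih fun s hs => hw s (List.mem_cons_of_mem _ hs)
    have h2 := hw _ List.mem_cons_self
    rw [List.length_cons]
    push_cast
    cases x <;> cases y <;> simp only [Crosses] at hs <;> simp [rule] at h2 <;> linarith

theorem length_le_length_substitute (k : Fin 4) (v : List DecoratedSymbol) :
    v.length ≤ (substitute k v).length := by
  induction v with
  | nil => simp
  | cons s v ih =>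
    have := List.length_pos_of_ne_nil (rule_ne_nil k s)
    simp only [substitute, List.flatMap_cons, List.length_append, List.length_cons] at ih ⊢
    omega

theorem length_rule_le_one_of_mem {k : Fin 4} {v : List DecoratedSymbol}
    (h : (substitute k v).length ≤ v.length) : ∀ s ∈ v, (rule k s).length ≤ 1 := by
  induction v with
  | nil => simp
  | cons s v ih =>
    have := List.length_pos_of_ne_nil (rule_ne_nil k s)
    have := length_le_length_substitute k v
    simp only [substitute, List.flatMap_cons, List.length_append, List.length_cons] at ih h this
    intro u hu
    rcases List.mem_cons.1 hu with rfl | hu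
    · omega
    · exact ih (by omega) u hu

/-- Substituting makes the word of a closed path longer, unless the direction is horizontal. -/
theorem Path.length_lt_length_substitute {k : Fin 4} {a b : ℝ} (ha : 0 < a) (hb : 0 ≤ b)
    (hk : 0 < inflateSnd k a b) {x : EdgeLabel} {t : ℝ} {v : List DecoratedSymbol}
    (h : Path a b x t v x t) (hv : v ≠ []) : v.length < (substitute k v).length := by
  by_contra! hle
  have h1 := length_rule_le_one_of_mem hle
  have hpos : (0 : ℝ) < v.length := by exact_mod_cast List.length_pos_of_ne_nil hv
  have hg := Real.goldenRatio_pos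
  -- Under `r_1` and `r_2` every arrow becomes at least two symbols.
  have key : k = 1 ∨ k = 2 → False := by
    intro hk
    rcases h.inv with ⟨rfl, -, -⟩ | ⟨y, t₁, w, rfl, hs, -⟩
    · exact absurd rfl hv
    · have := h1 _ List.mem_cons_self
      rcases hk with rfl | rfl <;> cases x <;> cases y <;> cases hs <;> simp [rule] at this
  fin_cases k
  · have := h.le_of_length_rule_zero hb h1
    have hb' : 0 < b := hk
    have := mul_pos hpos (mul_pos hg hb')
    linarith
  · exact key (.inl rfl)
  · exact key (.inr rfl)
  · have := h.le_of_length_rule_three ha.le h1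
    have := mul_pos hpos (mul_pos hg ha)
    linarith

/-! ### Horizontal closed paths. -/

theorem Path.horizontal_e1 {a : ℝ} (ha : 0 < a) {t t'' : ℝ} {w : List DecoratedSymbol}
    (h : Path a 0 e1 t w e1 t'') : ∃ N, w = (List.replicate N [s12, s21]).flatten := by
  induction hn : w.length using Nat.strong_induction_on generalizing t w with
  | _ n ih =>
    rcases h.inv with ⟨rfl, -, -⟩ | ⟨y, t₁, w, rfl, hs, h⟩
    · exact ⟨0, rfl⟩
    cases y <;> cases hs
    have h1 := abs_lt.1 h.abs_lt_width
    rcases h.inv with ⟨rfl, h, -⟩ | ⟨y, t₁, w, rfl, hs, h⟩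
    · cases h
    have h2 := abs_lt.1 h.abs_lt_width
    cases y <;> cases hs
    · obtain ⟨N, rfl⟩ := ih _ (by rw [← hn]; simp) h rfl
      exact ⟨N + 1, rfl⟩
    · simp only [width] at h1 h2
      linarith [ha]

theorem Path.horizontal_e3 {a : ℝ} (ha : 0 < a) {t t'' : ℝ} {w : List DecoratedSymbol}
    (h : Path a 0 e3 t w e3 t'') : ∃ N, w = (List.replicate N [s34, s43]).flatten := by
  induction hn : w.length using Nat.strong_induction_on generalizing t w with
  | _ n ih =>
    have h0 := abs_lt.1 h.abs_lt_width
    rcases h.inv with ⟨rfl, -, -⟩ | ⟨y, t₁, w, rfl, hs, h⟩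
    · exact ⟨0, rfl⟩
    have h1 := abs_lt.1 h.abs_lt_width
    cases y <;> cases hs <;> simp only [width] at h0 h1
    · linarith [ha]
    rcases h.inv with ⟨rfl, h, -⟩ | ⟨y, t₁, w, rfl, hs, h⟩
    · cases h
    have h2 := abs_lt.1 h.abs_lt_width
    cases y <;> cases hs
    · obtain ⟨N, rfl⟩ := ih _ (by rw [← hn]; simp) h rfl
      exact ⟨N + 1, rfl⟩
    · simp only [width] at h2
      linarith [ha]

theorem Path.horizontal {a : ℝ} (ha : 0 < a) {x : EdgeLabel} {t : ℝ} {w : List DecoratedSymbol}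
    (h : Path a 0 x t w x t) :
    ∃ s ∈ startingWords, ∃ N, w.IsRotated (List.replicate N s).flatten := by
  have hg := mul_pos Real.goldenRatio_pos ha
  have h0 := abs_lt.1 h.abs_lt_width
  cases x
  · obtain ⟨N, rfl⟩ := h.horizontal_e1 ha
    exact ⟨_, .inl rfl, N, .refl _⟩
  · rcases h.inv with ⟨rfl, -, -⟩ | ⟨y, t₁, w, rfl, hs, h'⟩
    · exact ⟨_, .inl rfl, 0, .refl _⟩
    have h1 := abs_lt.1 h'.abs_lt_width
    cases y <;> have hs' := hs <;> cases hs <;> simp only [width] at h0 h1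
    -- Moving the first symbol to the end turns a loop based at `2` into one based at `1`.
    · have hp := h'.append (.cons h.abs_lt_width hs' (.nil h'.abs_lt_width))
      obtain ⟨N, hN⟩ := hp.horizontal_e1 ha
      exact ⟨_, .inl rfl, N, hN ▸ List.isRotated_append (l := [s21]) (l' := w)⟩
    · linarith
  · obtain ⟨N, rfl⟩ := h.horizontal_e3 ha
    exact ⟨_, .inr rfl, N, .refl _⟩
  · rcases h.inv with ⟨rfl, -, -⟩ | ⟨y, t₁, w, rfl, hs, h'⟩
    · exact ⟨_, .inl rfl, 0, .refl _⟩
    have h1 := abs_lt.1 h'.abs_lt_width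
    cases y <;> have hs' := hs <;> cases hs <;> simp only [width] at h0 h1
    · have hp := h'.append (.cons h.abs_lt_width hs' (.nil h'.abs_lt_width))
      obtain ⟨N, hN⟩ := hp.horizontal_e3 ha
      exact ⟨_, .inr rfl, N, hN ▸ List.isRotated_append (l := [s43]) (l' := w)⟩
    · linarith
  · simp only [width] at h0
    linarith

/-! ### Descent to a horizontal direction. -/

/-- Every direction of the sector is the image of a direction of the sector under one of the four
affine automorphisms. -/
theorem exists_inflate {a b : ℝ} (ha : 0 < a) (hb : 0 ≤ b) :
    ∃ (k : Fin 4) (a' b' : ℝ), 0 < a' ∧ 0 ≤ b' ∧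
      a = inflateFst k a' b' ∧ b = inflateSnd k a' b' := by
  have hA := golden_sq_mul a
  have hB := golden_sq_mul b
  have hg := Real.goldenRatio_pos
  -- The subsectors are cut at `a = φ b`, `a = b` and `b = φ a`; the witnesses come from inverting
  -- the four determinant-one matrices.
  rcases lt_or_ge (Real.goldenRatio * b) a with h | h
  · exact ⟨0, a - Real.goldenRatio * b, b, by linarith, hb, by simp [inflateFst], rfl⟩
  rcases lt_or_ge b a with h' | h'
  · refine ⟨1, Real.goldenRatio * (a - b), Real.goldenRatio * b - a, mul_pos hg (by linarith),
      by linarith, ?_, ?_⟩ <;> simp only [inflateFst, inflateSnd] <;> linarith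
  rcases lt_or_ge b (Real.goldenRatio * a) with h'' | h''
  · refine ⟨2, Real.goldenRatio * a - b, Real.goldenRatio * (b - a), by linarith,
      mul_nonneg hg.le (by linarith), ?_, ?_⟩ <;> simp only [inflateFst, inflateSnd] <;> linarith
  · exact ⟨3, a, b - Real.goldenRatio * a, ha, by linarith, rfl, by simp [inflateSnd]⟩

theorem isRotated_flatMap {α β : Type*} (f : α → List β) {l l' : List α} (h : l.IsRotated l') :
    (l.flatMap f).IsRotated (l'.flatMap f) := by
  obtain ⟨n, hn, rfl⟩ := List.isRotated_iff_mod.1 h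
  rw [List.rotate_eq_drop_append_take hn, List.flatMap_append]
  have : l.flatMap f = (l.take n).flatMap f ++ (l.drop n).flatMap f := by
    rw [← List.flatMap_append, List.take_append_drop]
  rw [this]
  exact List.isRotated_append

theorem substitute_flatten_replicate (k : Fin 4) (N : ℕ) (v : List DecoratedSymbol) :
    substitute k (List.replicate N v).flatten = (List.replicate N (substitute k v)).flatten := by
  induction N with
  | zero => rfl
  | succ N ih =>
    simp only [List.replicate_succ, List.flatten_cons, ← ih]
    simp [substitute]

/-- The decorated cutting word of a closed path is, up to a rotation, a power of a word obtained
from a starting word by the substitutions. -/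
theorem Path.exists_isRotated {a b : ℝ} (ha : 0 < a) (hb : 0 ≤ b) {x : EdgeLabel} {t : ℝ}
    {w : List DecoratedSymbol} (h : Path a b x t w x t) (hw : w ≠ []) :
    ∃ s ∈ startingWords, ∃ (ks : List (Fin 4)) (N : ℕ),
      w.IsRotated (List.replicate N (applyRules ks s)).flatten := by
  induction hn : w.length using Nat.strong_induction_on generalizing a b x t w with
  | _ n ih =>
    rcases hb.eq_or_lt with rfl | hb
    · obtain ⟨s, hs, N, hN⟩ := h.horizontal ha
      exact ⟨s, hs, [], N, hN⟩
    have hlen := h.three_le_length ha hb hw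
    obtain ⟨k, a, b, ha', hb', rfl, rfl⟩ := exists_inflate ha hb.le
    -- Rebasing the loop at a marked crossing makes both its ends marked, as desubstitution
    -- requires.
    obtain ⟨w₁, w₂, y, t', rfl, h₁, hy, h₂⟩ := h.meetsMarked ha'.le hb' hlen
    obtain ⟨v, hv, hp⟩ := (h₂.append h₁).desubstitute ha'.le hb' hy hy
    have hv0 : v ≠ [] := by
      rintro rfl
      rw [substitute, List.flatMap_nil, List.append_eq_nil_iff] at hv
      exact hw (by simp [hv.1, hv.2])
    have hlt := hp.length_lt_length_substitute ha' hb' hb hv0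
    have hlen' : (substitute k v).length = n := by
      rw [← hv, ← hn, List.length_append, List.length_append, add_comm]
    obtain ⟨s, hs, ks, N, hN⟩ := ih _ (hlen' ▸ hlt) ha' hb' hp hv0 rfl
    refine ⟨s, hs, k :: ks, N, List.isRotated_append.trans ?_⟩
    rw [hv]
    exact substitute_flatten_replicate k N _ ▸ isRotated_flatMap (rule k) hN

/-! ### Reversal symmetry of the substitutions. -/

theorem reverseSwap_append (v w : List DecoratedSymbol) :
    reverseSwap (v ++ w) = reverseSwap w ++ reverseSwap v := by
  simp [reverseSwap]

theorem reverseSwap_rule (k : Fin 4) (s : DecoratedSymbol) :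
    reverseSwap (rule k s) = rule k s.swap := by
  obtain ⟨x, y⟩ := s
  fin_cases k <;> cases x <;> cases y <;> rfl

theorem reverseSwap_substitute (k : Fin 4) (w : List DecoratedSymbol) :
    reverseSwap (substitute k w) = substitute k (reverseSwap w) := by
  induction w with
  | nil => rfl
  | cons s w ih =>
    have h1 : substitute k (s :: w) = rule k s ++ substitute k w := rfl
    have h2 : reverseSwap (s :: w) = reverseSwap w ++ [s.swap] := by simp [reverseSwap]
    rw [h1, h2, reverseSwap_append, ih, reverseSwap_rule]
    simp [substitute]

theorem reverseSwap_applyRules {s : List DecoratedSymbol} (hs : s ∈ startingWords)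
    (ks : List (Fin 4)) : reverseSwap (applyRules ks s) = applyRules ks s := by
  induction ks with
  | nil => rcases hs with rfl | rfl <;> rfl
  | cons k ks ih =>
    have h : applyRules (k :: ks) s = substitute k (applyRules ks s) := rfl
    rw [h, reverseSwap_substitute, ih]

theorem flatten_reverseSwap (w : List DecoratedSymbol) :
    flatten (reverseSwap w) = (flatten w).reverse := by
  induction w with
  | nil => rfl
  | cons s w ih =>
    have h1 : reverseSwap (s :: w) = reverseSwap w ++ [s.swap] := by simp [reverseSwap]
    have h2 : flatten (s :: w) = [s.base, s.exponent] ++ flatten w := rfl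
    rw [h1, h2, List.reverse_append, ← ih]
    simp [flatten, DecoratedSymbol.swap]

theorem getElem?_flatten_replicate {α : Type*} (w : List α) (N i : ℕ) (hi : i < N * w.length) :
    (List.replicate N w).flatten[i]? = w[i % w.length]? := by
  induction N generalizing i with
  | zero => simp at hi
  | succ N ih =>
    rw [List.replicate_succ, List.flatten_cons]
    rcases lt_or_ge i w.length with h | h
    · rw [List.getElem?_append_left h, Nat.mod_eq_of_lt h]
    · rw [List.getElem?_append_right h, ih _ (by rw [Nat.succ_mul] at hi; omega),
        ← Nat.mod_eq_sub_mod h]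

/-! ### Blocks, periods and centres of symmetry. -/

namespace LinearTrajectory

variable (τ : LinearTrajectory)

@[simp]
theorem length_block (m : ℤ) (n : ℕ) : (τ.block m n).length = n := by
  simp [block]

theorem getElem_block (m : ℤ) (n j : ℕ) (hj : j < (τ.block m n).length) :
    (τ.block m n)[j] = ⟨τ.label (m + j), τ.label (m + j + 1)⟩ := by
  simp [block, decorated, cuttingSequence]

/-- The cutting sequence is symmetric about the crossing with index `m`. -/
def SymmetricAt (m : ℤ) : Prop := ∀ i, τ.label (m + i) = τ.label (m - i)

variable {τ}

theorem block_rotate {n : ℕ} (hper : Function.Periodic τ.label (n : ℤ)) (m : ℤ) (r : ℕ) :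
    (τ.block m n).rotate r = τ.block (m + r) n := by
  apply List.ext_getElem
  · simp
  intro j h1 h2
  rw [List.getElem_rotate, getElem_block, getElem_block, length_block]
  have key : ∀ c : ℤ, τ.label (m + ((j + r) % n : ℕ) + c) = τ.label (m + r + j + c) := by
    intro c
    have h := hper.int_mul ((j + r) / n : ℕ) (m + ((j + r) % n : ℕ) + c)
    rw [← h]
    congr 1
    have := Nat.mod_add_div (j + r) n
    have : (((j + r) % n : ℕ) : ℤ) + n * ((j + r) / n : ℕ) = j + r := by exact_mod_cast this
    linear_combination this
  have h0 := key 0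
  rw [add_zero, add_zero] at h0
  rw [h0, key 1]

theorem block_isRotated {n : ℕ} (hper : Function.Periodic τ.label (n : ℤ)) (m m' : ℤ) :
    (τ.block m n).IsRotated (τ.block m' n) := by
  have key : ∀ (p : ℤ) (j : ℕ), (τ.block p n).IsRotated (τ.block (p + j) n) :=
    fun p j => ⟨j, block_rotate hper p j⟩
  rcases le_total m m' with h | h
  · obtain ⟨j, hj⟩ := Int.eq_ofNat_of_zero_le (sub_nonneg.2 h)
    rw [show m' = m + j by omega]
    exact key _ _
  · obtain ⟨j, hj⟩ := Int.eq_ofNat_of_zero_le (sub_nonneg.2 h)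
    rw [show m = m' + j by omega]
    exact (key _ _).symm

theorem block_add_period {n : ℕ} (hper : Function.Periodic τ.label (n : ℤ)) (m : ℤ) :
    τ.block (m + n) n = τ.block m n := by
  rw [← block_rotate hper]
  have := List.rotate_length (τ.block m n)
  rwa [length_block] at this

/-- Reflection in `m` carries the labels at `p, …, p + n` to those at `2m - p - n, …, 2m - p`. -/
theorem SymmetricAt.reverseSwap_block {m : ℤ} (h : τ.SymmetricAt m) (p : ℤ) (n : ℕ) :
    reverseSwap (τ.block p n) = τ.block (2 * m - p - n) n := by
  apply List.ext_getElem
  · simp [reverseSwap]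
  intro j h1 h2
  simp only [reverseSwap, List.getElem_map, List.getElem_reverse, getElem_block,
    DecoratedSymbol.swap, length_block]
  rw [length_block] at h2
  have h3 := h (m - p - n + j)
  have h4 := h (m - p - n + j + 1)
  rw [show 2 * m - p - n + j = m + (m - p - n + j) by ring, h3,
    show m + (m - p - n + j) + 1 = m + (m - p - n + j + 1) by ring, h4]
  congr 2 <;> push_cast [Nat.sub_sub, show 1 + j ≤ n by omega] <;> ring

/-- The reflected block is the same block shifted by one period. Here `n` may be any period,
unrelated to the length of a generating word. -/
theorem SymmetricAt.palindromeProperties {m : ℤ} (h : τ.SymmetricAt m) {n : ℕ}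
    (hper : Function.Periodic τ.label (n : ℤ)) : PalindromeProperties (τ.block m n) := by
  have h1 : reverseSwap (τ.block m n) = τ.block m n := by
    rw [h.reverseSwap_block, ← block_add_period hper]
    congr 1
    ring
  refine ⟨h1, by rw [← flatten_reverseSwap, h1], ?_⟩
  apply List.ext_getElem
  · simp
  intro j h2 h3
  simp only [bases, List.length_tail, List.length_map, length_block] at h3
  simp only [bases, List.getElem_reverse, List.getElem_tail, List.getElem_map, getElem_block,
    List.length_tail, List.length_map, length_block]
  rw [h, ← hper]
  congr 1
  omega

theorem SymmetricAt.isRotated {m : ℤ} (h : τ.SymmetricAt m) {n : ℕ}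
    (hper : Function.Periodic τ.label (n : ℤ)) (p : ℤ) :
    (reverseSwap (τ.block p n)).IsRotated (τ.block p n) := by
  rw [h.reverseSwap_block]
  exact block_isRotated hper _ _

theorem ReadsAs.block_eq {m : ℤ} {w : List DecoratedSymbol} (h : τ.ReadsAs m w) :
    τ.block m w.length = w := by
  apply List.ext_getElem
  · simp
  intro j h1 h2
  rw [getElem_block, ← h.2 0 j h2]
  simp [decorated, cuttingSequence]

theorem ReadsAs.periodic {m : ℤ} {w : List DecoratedSymbol} (h : τ.ReadsAs m w) :
    Function.Periodic τ.label (w.length : ℤ) := by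
  intro i
  have hpos : (0 : ℤ) < w.length := by exact_mod_cast List.length_pos_of_ne_nil h.1
  obtain ⟨j, hj⟩ := Int.eq_ofNat_of_zero_le (Int.emod_nonneg (i - m) hpos.ne')
  have hlt : j < w.length := by
    have := Int.emod_lt_of_pos (i - m) hpos
    omega
  have hi := Int.emod_add_mul_ediv (i - m) w.length
  rw [hj] at hi
  have h1 := congrArg DecoratedSymbol.base (h.2 ((i - m) / w.length) j hlt)
  have h2 := congrArg DecoratedSymbol.base (h.2 ((i - m) / w.length + 1) j hlt)
  simp only [decorated, cuttingSequence] at h1 h2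
  rw [show i + w.length = m + ((i - m) / w.length + 1) * w.length + j by linear_combination -hi, h2,
    ← h1]
  congr 1
  linear_combination hi

theorem ReadsAs.symmetricAt {m : ℤ} {w : List DecoratedSymbol} (h : τ.ReadsAs m w)
    (hw : reverseSwap w = w) : τ.SymmetricAt m := by
  intro i
  have hper := h.periodic
  have hpos : (0 : ℤ) < w.length := by exact_mod_cast List.length_pos_of_ne_nil h.1
  obtain ⟨j, hj⟩ := Int.eq_ofNat_of_zero_le (Int.emod_nonneg i hpos.ne')
  have hlt : j < w.length := by
    have := Int.emod_lt_of_pos i hpos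
    omega
  have hi := Int.emod_add_mul_ediv i w.length
  rw [hj] at hi
  have h1 : τ.label (m + i) = τ.label (m + j) := by
    rw [← hper.int_mul (i / w.length) (m + j)]
    congr 1
    linear_combination -hi
  have h2 : τ.label (m - i) = τ.label (m + w.length - j) := by
    rw [← hper.int_mul (i / w.length + 1) (m - i)]
    congr 1
    push_cast
    linear_combination hi
  rw [h1, h2]
  have h3 : (reverseSwap (τ.block m w.length))[j]'(by simpa [reverseSwap] using hlt) =
      (τ.block m w.length)[j]'(by simpa using hlt) := by
    simp only [h.block_eq, hw]
  have h4 := congrArg DecoratedSymbol.base h3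
  simp only [reverseSwap, List.getElem_map, List.getElem_reverse, getElem_block,
    DecoratedSymbol.swap, length_block] at h4
  rw [← h4]
  congr 1
  push_cast [Nat.sub_sub, show 1 + j ≤ w.length by omega]
  ring

theorem exists_readsAs {n : ℕ} (hn : 0 < n) (hper : Function.Periodic τ.label (n : ℤ))
    {w : List DecoratedSymbol} {N : ℕ}
    (h : (τ.block 0 n).IsRotated (List.replicate N w).flatten) : ∃ m, τ.ReadsAs m w := by
  obtain ⟨r, hr⟩ := h
  rw [block_rotate hper] at hr
  have hlen : n = N * w.length := by
    have := congrArg List.length hr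
    simpa using this
  refine ⟨0 + r, ?_, fun k j hj => ?_⟩
  · rintro rfl
    simp at hlen
    omega
  have hpos : (0 : ℤ) < n := by exact_mod_cast hn
  obtain ⟨e, he⟩ := Int.eq_ofNat_of_zero_le (Int.emod_nonneg (k * w.length + j) hpos.ne')
  have hlt : e < n := by
    have := Int.emod_lt_of_pos (k * w.length + j) hpos
    omega
  have hi := Int.emod_add_mul_ediv (k * w.length + j) n
  rw [he] at hi
  -- Since `n` is a multiple of the length of `w`, reducing modulo `n` keeps the position inside
  -- `w`.
  have hmod : e % w.length = j := by
    have h1 : (e : ℤ) % w.length = j % w.length := by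
      apply Int.emod_emod_of_dvd _ (dvd_refl _) |>.symm.trans
      rw [show (e : ℤ) = j + w.length * (k - N * ((k * w.length + j) / n)) by
        rw [hlen] at hi ⊢; push_cast at hi ⊢; linear_combination hi]
      simp
    have h2 : e % w.length = j % w.length := by exact_mod_cast h1
    rwa [Nat.mod_eq_of_lt hj] at h2
  have key := getElem?_flatten_replicate w N e (hlen ▸ hlt)
  rw [← hr, hmod, List.getElem?_eq_getElem (by simpa using hlt), List.getElem?_eq_getElem hj,
    Option.some_inj, getElem_block] at key
  rw [← key]
  have hq : ∀ c : ℤ, τ.label (0 + r + k * w.length + j + c) = τ.label (0 + r + e + c) := by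
    intro c
    rw [← hper.int_mul ((k * w.length + j) / n) (0 + r + e + c)]
    congr 1
    linear_combination -hi
  have h0 := hq 0
  rw [add_zero, add_zero] at h0
  simp only [decorated, cuttingSequence]
  rw [h0, hq 1]

end LinearTrajectory

/-! ### Coordinates of the pentagon. -/

theorem cos_pi_div_five_eq : Real.cos (Real.pi / 5) = Real.goldenRatio / 2 := by
  rw [Real.cos_pi_div_five, Real.goldenRatio]; ring

theorem sin_pi_div_five_pos : 0 < Real.sin (Real.pi / 5) :=
  Real.sin_pos_of_pos_of_lt_pi (by positivity) (by linarith [Real.pi_pos])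

theorem sin_sq_pi_div_five : Real.sin (Real.pi / 5) ^ 2 = (3 - Real.goldenRatio) / 4 := by
  have h := Real.sin_sq_add_cos_sq (Real.pi / 5)
  rw [cos_pi_div_five_eq] at h
  linear_combination h - Real.goldenRatio_sq / 4

theorem vertex_eq (k : ℕ) :
    vertex k = ⟨-Real.sin (2 * Real.pi * k / 5), Real.cos (2 * Real.pi * k / 5)⟩ := by
  rw [vertex, Complex.exp_mul_I, ← Complex.ofReal_cos, ← Complex.ofReal_sin,
    add_comm (Real.pi / 2), Real.cos_add_pi_div_two, Real.sin_add_pi_div_two]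
  apply Complex.ext <;> simp [-Complex.ofReal_sin, -Complex.ofReal_cos]

theorem sin_two_pi_div_five :
    Real.sin (2 * (Real.pi / 5)) = Real.goldenRatio * Real.sin (Real.pi / 5) := by
  rw [Real.sin_two_mul, cos_pi_div_five_eq]; ring

theorem cos_two_pi_div_five : Real.cos (2 * (Real.pi / 5)) = (Real.goldenRatio - 1) / 2 := by
  rw [Real.cos_two_mul, cos_pi_div_five_eq]
  linear_combination Real.goldenRatio_sq / 2

theorem vertex_zero : vertex 0 = ⟨0, 1⟩ := by
  simp [vertex_eq]

theorem vertex_one :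
    vertex 1 = ⟨-(Real.goldenRatio * Real.sin (Real.pi / 5)), (Real.goldenRatio - 1) / 2⟩ := by
  rw [vertex_eq, show 2 * Real.pi * (1 : ℕ) / 5 = 2 * (Real.pi / 5) by push_cast; ring,
    sin_two_pi_div_five, cos_two_pi_div_five]

theorem vertex_two : vertex 2 = ⟨-Real.sin (Real.pi / 5), -(Real.goldenRatio / 2)⟩ := by
  rw [vertex_eq, show 2 * Real.pi * (2 : ℕ) / 5 = Real.pi - Real.pi / 5 by push_cast; ring,
    Real.sin_pi_sub, Real.cos_pi_sub, cos_pi_div_five_eq]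

theorem vertex_three : vertex 3 = ⟨Real.sin (Real.pi / 5), -(Real.goldenRatio / 2)⟩ := by
  rw [vertex_eq, show 2 * Real.pi * (3 : ℕ) / 5 = Real.pi / 5 + Real.pi by push_cast; ring,
    Real.sin_add_pi, Real.cos_add_pi, cos_pi_div_five_eq, neg_neg]

theorem vertex_four :
    vertex 4 = ⟨Real.goldenRatio * Real.sin (Real.pi / 5), (Real.goldenRatio - 1) / 2⟩ := by
  rw [vertex_eq, show 2 * Real.pi * (4 : ℕ) / 5 = 2 * Real.pi - 2 * (Real.pi / 5) by
    push_cast; ring, Real.sin_two_pi_sub, Real.cos_two_pi_sub, sin_two_pi_div_five,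
    cos_two_pi_div_five, neg_neg]

/-! ### From chords of the pentagons to symbolic crossings. -/

/-- The cross product of two vectors of the plane. -/
def cross (u v : ℂ) : ℝ := u.re * v.im - u.im * v.re

/-- The oriented edge of the upward pentagon with a given label, as a vector. -/
noncomputable def edgeVector (l : EdgeLabel) : ℂ := edgeEnd l - edgeStart l

/-- Twice the midpoint of an edge of the upward pentagon. -/
noncomputable def edgeSum (l : EdgeLabel) : ℂ := edgeStart l + edgeEnd l

/-- The transverse width of the edge `1`. -/
noncomputable def fstWidth (d : ℂ) : ℝ := -cross d (edgeVector e1)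

/-- The transverse width of the edge `5`. -/
noncomputable def sndWidth (d : ℂ) : ℝ := -cross d (edgeVector e5)

theorem cross_edgeVector (d : ℂ) (l : EdgeLabel) :
    cross d (edgeVector l) = (match l with | e1 | e3 | e5 => -1 | e2 | e4 => 1) *
      width (fstWidth d) (sndWidth d) l := by
  have hg := Real.goldenRatio_sq
  cases l <;> simp only [cross, edgeVector, edgeStart, edgeEnd, vertex_zero, vertex_one, vertex_two,
    vertex_three, vertex_four, fstWidth, sndWidth, width, Complex.sub_re, Complex.sub_im]
  · ring
  · ring
  · linear_combination (-d.re / 2 - Real.sin (Real.pi / 5) * d.im) * hg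
  · linear_combination (d.re / 2 + Real.sin (Real.pi / 5) * d.im) * hg
  · ring

/-- The signs make the upward pentagon be entered through `1`, `3`, `5` and left through `2`, `4`.
The widths then rule out the pairs `1, 4` and `5, 2`, which leaves the arrows of the transition
diagram. -/
theorem crosses_of_height {d : ℂ} (ha : 0 < fstWidth d) (hb : 0 ≤ sndWidth d) {x y : EdgeLabel}
    {t t' : ℝ} (hx : cross d (edgeVector x) < 0) (hy : 0 < cross d (edgeVector y))
    (ht : |t| < |cross d (edgeVector x)|) (ht' : |t'| < |cross d (edgeVector y)|)
    (h : t' - t = cross d (edgeSum y) - cross d (edgeSum x)) :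
    |t| < width (fstWidth d) (sndWidth d) x ∧ |t'| < width (fstWidth d) (sndWidth d) y ∧
      Crosses (fstWidth d) (sndWidth d) x t y t' := by
  have hg := Real.goldenRatio_sq
  have hga := mul_pos Real.goldenRatio_pos ha
  have hgb := mul_nonneg Real.goldenRatio_pos.le hb
  have hA := golden_sq_mul d.re
  have hB := golden_sq_mul (Real.sin (Real.pi / 5) * d.im)
  rw [abs_of_neg hx] at ht
  rw [abs_of_pos hy] at ht'
  have hwx := cross_edgeVector d x
  have hwy := cross_edgeVector d y
  have hwx' : -cross d (edgeVector x) = width (fstWidth d) (sndWidth d) x := by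
    cases x <;> simp only [width] at hwx ⊢ <;> linarith
  have hwy' : cross d (edgeVector y) = width (fstWidth d) (sndWidth d) y := by
    cases y <;> simp only [width] at hwy ⊢ <;> linarith
  rw [hwx'] at ht
  rw [hwy'] at ht'
  refine ⟨ht, ht', ?_⟩
  rw [abs_lt] at ht ht'
  clear hwx' hwy'
  cases x <;> simp only [width] at hwx ht <;> first | (exfalso; linarith) | skip
  all_goals
    cases y <;> simp only [width] at hwy ht' <;> first | (exfalso; linarith) | skip
  all_goals
    clear hwx hwy hx hy
    simp only [cross, edgeVector, edgeSum, edgeStart, edgeEnd, vertex_zero, vertex_one, vertex_two,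
      vertex_three, vertex_four, fstWidth, sndWidth, Complex.sub_re, Complex.sub_im,
      Complex.add_re, Complex.add_im, Crosses] at h ha hb hga hgb ht ht' ⊢
    linarith

theorem cross_add (u v w : ℂ) : cross u (v + w) = cross u v + cross u w := by
  simp only [cross, Complex.add_re, Complex.add_im]; ring

theorem cross_neg (u v : ℂ) : cross u (-v) = -cross u v := by
  simp only [cross, Complex.neg_re, Complex.neg_im]; ring

theorem cross_sub (u v w : ℂ) : cross u (v - w) = cross u v - cross u w := by
  rw [sub_eq_add_neg, cross_add, cross_neg, sub_eq_add_neg]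

theorem cross_smul (u v : ℂ) (r : ℝ) : cross u (r • v) = r * cross u v := by
  simp only [cross, Complex.smul_re, Complex.smul_im, smul_eq_mul]; ring

theorem cross_swap (u v : ℂ) : cross u v = -cross v u := by
  simp only [cross]; ring

/-- The end points of an edge lie on the inner side of each of the other edges. -/
theorem depth_edge {l l' : EdgeLabel} (h : l ≠ l') :
    cross (edgeVector l) (edgeStart l) ≤ cross (edgeVector l) (edgeStart l') ∧
    cross (edgeVector l) (edgeStart l) ≤ cross (edgeVector l) (edgeEnd l') ∧
    2 * cross (edgeVector l) (edgeStart l) <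
      cross (edgeVector l) (edgeStart l') + cross (edgeVector l) (edgeEnd l') := by
  have hs := sin_pi_div_five_pos
  have h1 := golden_sq_mul (Real.sin (Real.pi / 5))
  have h2 := mul_lt_mul_of_pos_right golden_gt hs
  have h3 := mul_lt_mul_of_pos_right golden_lt hs
  cases l <;> cases l' <;> first | exact absurd rfl h | skip
  all_goals
    clear h
    simp only [cross, edgeVector, edgeStart, edgeEnd, vertex_zero, vertex_one, vertex_two,
      vertex_three, vertex_four, Complex.sub_re, Complex.sub_im]
    refine ⟨?_, ?_, ?_⟩ <;> linarith

theorem depth_of_mem {l : EdgeLabel} {p : ℂ} (h : p ∈ openSegment ℝ (edgeStart l) (edgeEnd l)) :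
    cross (edgeVector l) p = cross (edgeVector l) (edgeStart l) := by
  obtain ⟨u, v, hu, hv, huv, rfl⟩ := h
  obtain rfl : u = 1 - v := by linarith
  simp only [cross, edgeVector, Complex.add_re, Complex.add_im, Complex.smul_re, Complex.smul_im,
    smul_eq_mul, Complex.sub_re, Complex.sub_im]
  ring

theorem depth_lt_of_mem {l l' : EdgeLabel} (hl : l ≠ l') {p : ℂ}
    (h : p ∈ openSegment ℝ (edgeStart l') (edgeEnd l')) :
    cross (edgeVector l) (edgeStart l) < cross (edgeVector l) p := by
  obtain ⟨u, v, hu, hv, huv, rfl⟩ := h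
  obtain ⟨h1, h2, h3⟩ := depth_edge hl
  rw [cross_add, cross_smul, cross_smul]
  have h4 := mul_nonneg hu.le (sub_nonneg.2 h1)
  have h5 := mul_nonneg hv.le (sub_nonneg.2 h2)
  obtain rfl : u = 1 - v := by linarith
  rcases h1.lt_or_eq with h | h
  · have := mul_pos hu (sub_pos.2 h)
    linarith
  · have := mul_pos hv (sub_pos.2 (show cross (edgeVector l) (edgeStart l) <
      cross (edgeVector l) (edgeEnd l') by linarith))
    linarith

/-- A chord of the upward pentagon enters through an edge from its outer side, and leaves through
an edge from its inner side. -/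
theorem chord_signs {l l' : EdgeLabel} (hl : l ≠ l') {p q d : ℂ} {r : ℝ} (hr : 0 < r)
    (hp : p ∈ openSegment ℝ (edgeStart l) (edgeEnd l))
    (hq : q ∈ openSegment ℝ (edgeStart l') (edgeEnd l')) (h : q - p = r • d) :
    cross d (edgeVector l) < 0 ∧ 0 < cross d (edgeVector l') := by
  have h1 := congrArg (cross (edgeVector l)) h
  have h2 := congrArg (cross (edgeVector l')) h
  rw [cross_sub, cross_smul, depth_of_mem hp] at h1
  rw [cross_sub, cross_smul, depth_of_mem hq] at h2
  have h3 := depth_lt_of_mem hl hq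
  have h4 := depth_lt_of_mem hl.symm hp
  rw [cross_swap d, cross_swap d, neg_lt_zero, neg_pos]
  constructor
  · exact pos_of_mul_pos_right (b := cross (edgeVector l) d) (by linarith) hr.le
  · by_contra! hc
    have := mul_nonneg hr.le hc
    linarith

theorem abs_offset_lt {l : EdgeLabel} {p d : ℂ}
    (hp : p ∈ openSegment ℝ (edgeStart l) (edgeEnd l)) (hd : cross d (edgeVector l) ≠ 0) :
    |2 * cross d p - cross d (edgeSum l)| < |cross d (edgeVector l)| := by
  obtain ⟨u, v, hu, hv, huv, rfl⟩ := hp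
  obtain rfl : u = 1 - v := by linarith
  have : 2 * cross d ((1 - v) • edgeStart l + v • edgeEnd l) - cross d (edgeSum l) =
      (2 * v - 1) * cross d (edgeVector l) := by
    rw [cross_add, cross_smul, cross_smul, edgeSum, edgeVector, cross_add, cross_sub]
    ring
  rw [this, abs_mul]
  have h1 : |2 * v - 1| < 1 := abs_lt.2 ⟨by linarith, by linarith⟩
  have h2 := abs_pos.2 hd
  nlinarith

/-- The half-turn exchanging the pentagons fixes edge midpoints; it negates offsets and reverses
time. -/
theorem Crosses.symm_neg {a b t t' : ℝ} {x y : EdgeLabel} (h : Crosses a b x t y t') :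
    Crosses a b y (-t') x (-t) := by
  cases x <;> cases y <;> simp only [Crosses] at h ⊢ <;> linarith

theorem neg_mem_openSegment {p u v : ℂ} (h : p ∈ openSegment ℝ (-u) (-v)) :
    -p ∈ openSegment ℝ u v := by
  obtain ⟨r, s, hr, hs, hrs, rfl⟩ := h
  exact ⟨r, s, hr, hs, hrs, by simp [smul_neg, add_comm]⟩

namespace LinearTrajectory

/-- Twice the transverse offset of a crossing from the midpoint of the edge. -/
noncomputable def offset (τ : LinearTrajectory) (i : ℤ) : ℝ :=
  match τ.face i with
  | .up => -(2 * cross τ.dir (τ.entry i) - cross τ.dir (edgeSum (τ.label i)))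
  | .down => -(2 * cross τ.dir (τ.entry i) + cross τ.dir (edgeSum (τ.label i)))

theorem crosses (τ : LinearTrajectory) (ha : 0 < fstWidth τ.dir) (hb : 0 ≤ sndWidth τ.dir)
    (i : ℤ) :
    |τ.offset i| < width (fstWidth τ.dir) (sndWidth τ.dir) (τ.label i) ∧
    Crosses (fstWidth τ.dir) (sndWidth τ.dir) (τ.label i) (τ.offset i) (τ.label (i + 1))
      (τ.offset (i + 1)) := by
  obtain ⟨r, hr, hrd⟩ := τ.straight i
  have hrd' : τ.exit i - τ.entry i = r • τ.dir := by rw [hrd, Complex.real_smul]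
  have hen := τ.entry_mem i
  have hex := τ.exit_mem i
  have hne := τ.label_ne i
  have hes := τ.entry_succ i
  have hfs := τ.face_succ i
  have hself : cross τ.dir τ.dir = 0 := by simp only [cross]; ring
  have hc : cross τ.dir (τ.exit i) = cross τ.dir (τ.entry i) := by
    have := congrArg (cross τ.dir) hrd'
    rw [cross_sub, cross_smul, hself, mul_zero] at this
    linarith
  cases hf : τ.face i
  · rw [hf] at hen hex hes hfs
    simp only [openEdge, gluing, Face.other] at hen hex hes hfs
    obtain ⟨h1, h2⟩ := chord_signs hne hr hen hex hrd'
    have h3 := abs_offset_lt hen h1.ne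
    have h4 := abs_offset_lt hex h2.ne'
    have e1 : τ.offset i = -(2 * cross τ.dir (τ.entry i) - cross τ.dir (edgeSum (τ.label i))) := by
      simp only [offset, hf]
    have e2 : τ.offset (i + 1) =
        -(2 * cross τ.dir (τ.exit i) - cross τ.dir (edgeSum (τ.label (i + 1)))) := by
      simp only [offset, hfs, hes, cross_add, cross_neg, edgeSum]
      ring
    rw [← abs_neg, ← e1] at h3
    rw [← abs_neg, ← e2] at h4
    obtain ⟨h5, -, h6⟩ := crosses_of_height ha hb h1 h2 h3 h4 (by rw [e1, e2, hc]; ring)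
    exact ⟨h5, h6⟩
  · rw [hf] at hen hex hes hfs
    simp only [openEdge, gluing, Face.other] at hen hex hes hfs
    have hen' := neg_mem_openSegment hen
    have hex' := neg_mem_openSegment hex
    -- Negation turns a chord of the downward pentagon into a chord of the upward one in the same
    -- direction, with entry and exit exchanged.
    obtain ⟨h1, h2⟩ := chord_signs hne.symm hr hex' hen' (by rw [← hrd']; ring)
    have h3 := abs_offset_lt hen' h2.ne'
    have h4 := abs_offset_lt hex' h1.ne
    have e1 : τ.offset i = -(2 * cross τ.dir (τ.entry i) + cross τ.dir (edgeSum (τ.label i))) := by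
      simp only [offset, hf]
    have e2 : τ.offset (i + 1) =
        -(2 * cross τ.dir (τ.exit i) + cross τ.dir (edgeSum (τ.label (i + 1)))) := by
      simp only [offset, hfs, hes, cross_add, edgeSum]
      ring
    have e3 : 2 * cross τ.dir (-τ.entry i) - cross τ.dir (edgeSum (τ.label i)) = τ.offset i := by
      rw [cross_neg, e1]; ring
    have e4 : 2 * cross τ.dir (-τ.exit i) - cross τ.dir (edgeSum (τ.label (i + 1))) =
        τ.offset (i + 1) := by
      rw [cross_neg, e2]; ring
    rw [e3, ← abs_neg] at h3
    rw [e4, ← abs_neg] at h4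
    obtain ⟨-, h5, h6⟩ := crosses_of_height ha hb h1 h2 h4 h3 (by rw [e1, e2, hc]; ring)
    rw [abs_neg] at h5
    have h7 := h6.symm_neg
    rw [neg_neg, neg_neg] at h7
    exact ⟨h5, h7⟩

theorem path (τ : LinearTrajectory) (ha : 0 < fstWidth τ.dir) (hb : 0 ≤ sndWidth τ.dir)
    (m : ℤ) (n : ℕ) :
    Path (fstWidth τ.dir) (sndWidth τ.dir) (τ.label m) (τ.offset m) (τ.block m n)
      (τ.label (m + n)) (τ.offset (m + n)) := by
  induction n generalizing m with
  | zero => simpa [block] using Path.nil (τ.crosses ha hb m).1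
  | succ n ih =>
    have h := τ.crosses ha hb m
    have hblock : τ.block m (n + 1) = ⟨τ.label m, τ.label (m + 1)⟩ :: τ.block (m + 1) n := by
      simp only [block, decorated, cuttingSequence, List.ofFn_succ]
      simp only [Fin.val_zero, Nat.cast_zero, add_zero, Fin.val_succ, Nat.cast_add, Nat.cast_one,
        List.cons.injEq, true_and]
      congr 1
      funext j
      rw [show m + ((j : ℕ) + 1 : ℤ) = m + 1 + (j : ℕ) by ring]
    rw [hblock, show m + ((n + 1 : ℕ) : ℤ) = m + 1 + n by push_cast; ring]
    exact .cons h.1 h.2 (ih (m + 1))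

/-- A periodic cutting sequence closes up. -/
theorem offset_add_period (τ : LinearTrajectory) (ha : 0 < fstWidth τ.dir)
    (hb : 0 ≤ sndWidth τ.dir) {n : ℕ} (hper : Function.Periodic τ.label (n : ℤ)) :
    τ.offset n = τ.offset 0 := by
  -- The shift depends only on the two labels, so the drift over a period is constant; a nonzero
  -- drift would eventually exceed the width of the edge.
  have hstep : ∀ i, τ.offset (i + n + 1) - τ.offset (i + n) = τ.offset (i + 1) - τ.offset i := by
    intro i
    have h1 := (τ.crosses ha hb i).2
    have h2 := (τ.crosses ha hb (i + n)).2
    rw [hper, show i + n + 1 = i + 1 + n by ring, hper] at h2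
    rw [show i + n + 1 = i + 1 + n by ring]
    revert h1 h2
    cases τ.label i <;> cases τ.label (i + 1) <;> simp only [Crosses] <;>
      intro h1 h2 <;> first | exact h1.elim | linarith
  have hdrift : ∀ i : ℕ, τ.offset (i + n) - τ.offset i = τ.offset n - τ.offset 0 := by
    intro i
    induction i with
    | zero => simp
    | succ i ih =>
      have := hstep i
      push_cast
      rw [show (i : ℤ) + 1 + n = i + n + 1 by ring]
      linarith
  have hmul : ∀ k : ℕ, τ.offset (k * n) - τ.offset 0 = k * (τ.offset n - τ.offset 0) := by
    intro k
    induction k with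
    | zero => simp
    | succ k ih =>
      have := hdrift (k * n)
      push_cast at this ⊢
      rw [add_mul, one_mul]
      linarith
  have hbound : ∀ k : ℕ, |τ.offset (k * n)| <
      width (fstWidth τ.dir) (sndWidth τ.dir) (τ.label 0) := by
    intro k
    have h := (τ.crosses ha hb (k * n)).1
    have := hper.nat_mul k 0
    simp only [zero_add] at this
    rwa [this] at h
  by_contra hne
  have hpos : 0 < |τ.offset n - τ.offset 0| := abs_pos.2 (sub_ne_zero.2 hne)
  obtain ⟨k, hk⟩ := exists_nat_gt
    (2 * width (fstWidth τ.dir) (sndWidth τ.dir) (τ.label 0) / |τ.offset n - τ.offset 0|)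
  rw [div_lt_iff₀ hpos] at hk
  have h0 := hbound 0
  simp only [Nat.cast_zero, zero_mul] at h0
  have h1 := abs_sub (τ.offset (k * n)) (τ.offset 0)
  rw [hmul, abs_mul, Nat.abs_cast] at h1
  linarith [hbound k]

theorem exists_readsAs_applyRules (τ : LinearTrajectory) (ha : 0 < fstWidth τ.dir)
    (hb : 0 ≤ sndWidth τ.dir) {n : ℕ} (hn : 0 < n) (hper : Function.Periodic τ.label (n : ℤ)) :
    ∃ s ∈ startingWords, ∃ (ks : List (Fin 4)) (m : ℤ), τ.ReadsAs m (applyRules ks s) := by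
  have h := τ.path ha hb 0 n
  rw [zero_add, τ.offset_add_period ha hb hper, ← zero_add (n : ℤ), hper] at h
  have hw : τ.block 0 n ≠ [] := by
    rw [← List.length_pos_iff, length_block]
    exact hn
  obtain ⟨s, hs, ks, N, hN⟩ := h.exists_isRotated ha hb hw
  obtain ⟨m, hm⟩ := exists_readsAs hn hper hN
  exact ⟨s, hs, ks, m, hm⟩

end LinearTrajectory

/-! ### The sector, and its rotations by `π / 5`. -/

/-- The sector of directions, in coordinates. -/
theorem widths_of_angle {d : ℂ} {r θ : ℝ} (hr : 0 < r) (h0 : 0 ≤ θ) (h1 : θ < Real.pi / 5)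
    (hd : d = r * Complex.exp (θ * Complex.I)) : 0 < fstWidth d ∧ 0 ≤ sndWidth d := by
  have hre : d.re = r * Real.cos θ := by
    rw [hd, Complex.re_ofReal_mul, Complex.exp_ofReal_mul_I_re]
  have him : d.im = r * Real.sin θ := by
    rw [hd, Complex.im_ofReal_mul, Complex.exp_ofReal_mul_I_im]
  have hs := sin_pi_div_five_pos
  have hsin : 0 ≤ Real.sin θ := Real.sin_nonneg_of_nonneg_of_le_pi h0 (by linarith [Real.pi_pos])
  have hsub : 0 < Real.sin (Real.pi / 5 - θ) :=
    Real.sin_pos_of_pos_of_lt_pi (by linarith) (by linarith [Real.pi_pos])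
  constructor
  · have : fstWidth d = 2 * r * Real.sin (Real.pi / 5) * Real.sin (Real.pi / 5 - θ) := by
      rw [Real.sin_sub, cos_pi_div_five_eq]
      simp only [fstWidth, cross, edgeVector, edgeStart, edgeEnd, vertex_zero, vertex_one,
        Complex.sub_re, Complex.sub_im, hre, him]
      linear_combination (-2 * r * Real.cos θ) * sin_sq_pi_div_five
    rw [this]
    positivity
  · have : sndWidth d = 2 * r * Real.sin (Real.pi / 5) * Real.sin θ := by
      simp only [sndWidth, cross, edgeVector, edgeStart, edgeEnd, vertex_two, vertex_three,
        Complex.sub_re, Complex.sub_im, hre, him]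
      ring
    rw [this]
    positivity

/-- The label of the image of an edge under the rotation by `π / 5`. -/
def rotateLabel : EdgeLabel → EdgeLabel
  | e1 => e4
  | e2 => e5
  | e3 => e2
  | e4 => e3
  | e5 => e1

theorem rotateLabel_injective : Function.Injective rotateLabel := by
  intro x y h
  cases x <;> cases y <;> first | rfl | cases h

/-- The rotation by `π / 5`. -/
noncomputable def tenthTurn : ℂ := Complex.exp ((Real.pi / 5 : ℝ) * Complex.I)

/-- The angle `π / 5` equals three fifths of a full turn minus a half-turn. -/
theorem vertex_mul_tenthTurn (k : ℕ) : vertex k * tenthTurn = -vertex (k + 3) := by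
  rw [vertex, vertex, tenthTurn, ← Complex.exp_add, ← Complex.exp_sub_pi_mul_I]
  congr 1
  push_cast
  ring

theorem vertex_add_five (k : ℕ) : vertex (k + 5) = vertex k := by
  refine Eq.trans ?_ (Complex.exp_periodic _)
  rw [vertex]
  congr 1
  push_cast
  ring

theorem edgeStart_mul_tenthTurn (l : EdgeLabel) :
    edgeStart l * tenthTurn = -edgeStart (rotateLabel l) := by
  cases l <;> simp only [edgeStart, rotateLabel, vertex_mul_tenthTurn]
  · exact congrArg _ (vertex_add_five 2)
  · exact congrArg _ (vertex_add_five 1)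
  · exact congrArg _ (vertex_add_five 0)

theorem edgeEnd_mul_tenthTurn (l : EdgeLabel) :
    edgeEnd l * tenthTurn = -edgeEnd (rotateLabel l) := by
  cases l <;> simp only [edgeEnd, rotateLabel, vertex_mul_tenthTurn]
  · exact congrArg _ (vertex_add_five 0)
  · exact congrArg _ (vertex_add_five 2)
  · exact congrArg _ (vertex_add_five 1)

theorem mul_mem_openSegment {p u v c : ℂ} (h : p ∈ openSegment ℝ u v) :
    p * c ∈ openSegment ℝ (u * c) (v * c) := by
  obtain ⟨r, s, hr, hs, hrs, rfl⟩ := h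
  exact ⟨r, s, hr, hs, hrs, by simp [add_mul, mul_assoc]⟩

theorem mul_tenthTurn_mem_openEdge {f : Face} {l : EdgeLabel} {p : ℂ} (h : p ∈ openEdge f l) :
    p * tenthTurn ∈ openEdge f.other (rotateLabel l) := by
  have h' := fun u v (h : p ∈ openSegment ℝ u v) => mul_mem_openSegment (c := tenthTurn) h
  cases f
  · have := h' _ _ h
    rwa [edgeStart_mul_tenthTurn, edgeEnd_mul_tenthTurn] at this
  · have := h' _ _ h
    rwa [neg_mul, neg_mul, edgeStart_mul_tenthTurn, edgeEnd_mul_tenthTurn, neg_neg, neg_neg] at this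

theorem gluing_mul_tenthTurn (f : Face) (l : EdgeLabel) :
    gluing f l * tenthTurn = gluing f.other (rotateLabel l) := by
  cases f <;> simp only [gluing, Face.other, neg_mul, add_mul, edgeStart_mul_tenthTurn,
    edgeEnd_mul_tenthTurn] <;> ring

namespace LinearTrajectory

/-- The image of a trajectory under the rotation of the surface by `π / 5`. -/
noncomputable def rotate (τ : LinearTrajectory) : LinearTrajectory where
  dir := τ.dir * tenthTurn
  dir_ne_zero := mul_ne_zero τ.dir_ne_zero (Complex.exp_ne_zero _)
  label i := rotateLabel (τ.label i)
  face i := (τ.face i).other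
  entry i := τ.entry i * tenthTurn
  exit i := τ.exit i * tenthTurn
  entry_mem i := mul_tenthTurn_mem_openEdge (τ.entry_mem i)
  exit_mem i := mul_tenthTurn_mem_openEdge (τ.exit_mem i)
  label_ne i := rotateLabel_injective.ne (τ.label_ne i)
  straight i := by
    obtain ⟨s, hs, h⟩ := τ.straight i
    exact ⟨s, hs, by rw [← sub_mul, h, mul_assoc]⟩
  face_succ i := by rw [τ.face_succ]
  entry_succ i := by rw [τ.entry_succ, add_mul, gluing_mul_tenthTurn]

/-- After `j` rotations the direction lies in the sector; a symmetry found there pulls back because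
relabelling is injective. -/
theorem exists_symmetricAt_of_angle {n : ℕ} (hn : 0 < n) {r β : ℝ} (hr : 0 < r) (h0 : 0 ≤ β)
    (h1 : β < Real.pi / 5) (j : ℕ) (τ : LinearTrajectory)
    (hper : Function.Periodic τ.label (n : ℤ))
    (hd : τ.dir = r * Complex.exp ((β - j * (Real.pi / 5) : ℝ) * Complex.I)) :
    ∃ m, τ.SymmetricAt m := by
  induction j generalizing τ with
  | zero =>
    obtain ⟨ha, hb⟩ := widths_of_angle hr h0 h1 (by simpa using hd)
    obtain ⟨s, hs, ks, m, hm⟩ := τ.exists_readsAs_applyRules ha hb hn hper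
    exact ⟨m, hm.symmetricAt (reverseSwap_applyRules hs ks)⟩
  | succ j ih =>
    obtain ⟨m, hm⟩ := ih τ.rotate (fun i => congrArg rotateLabel (hper i)) (by
      change τ.dir * tenthTurn = _
      rw [hd, tenthTurn, mul_assoc, ← Complex.exp_add]
      congr 2
      push_cast
      ring)
    exact ⟨m, fun i => rotateLabel_injective (hm i)⟩

theorem exists_symmetricAt (τ : LinearTrajectory) {n : ℕ} (hn : 0 < n)
    (hper : Function.Periodic τ.label (n : ℤ)) : ∃ m, τ.SymmetricAt m := by
  set x := τ.dir.arg / (Real.pi / 5) with hx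
  have hp : 0 < Real.pi / 5 := by positivity
  -- The number of rotations must be a natural number, and ten of them make a full turn, hence the
  -- residue modulo `10`.
  obtain ⟨j, hj⟩ := Int.eq_ofNat_of_zero_le (Int.emod_nonneg (-⌊x⌋) (show (10 : ℤ) ≠ 0 by norm_num))
  have hdiv := Int.emod_add_mul_ediv (-⌊x⌋) 10
  rw [hj] at hdiv
  refine exists_symmetricAt_of_angle hn (norm_pos_iff.2 τ.dir_ne_zero)
    (mul_nonneg (Int.fract_nonneg x) hp.le)
    (by nlinarith [Int.fract_lt_one x]) j τ hper ?_
  conv_lhs => rw [← Complex.norm_mul_exp_arg_mul_I τ.dir]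
  congr 1
  have harg : τ.dir.arg = x * (Real.pi / 5) := by rw [hx]; field_simp
  have hcast : (j : ℝ) + 10 * ((-⌊x⌋ / 10 : ℤ) : ℝ) = -⌊x⌋ := by exact_mod_cast hdiv
  rw [Complex.exp_eq_exp_iff_exists_int]
  refine ⟨-(-⌊x⌋ / 10), ?_⟩
  have : τ.dir.arg = Int.fract x * (Real.pi / 5) - j * (Real.pi / 5) +
      (-(-⌊x⌋ / 10) : ℤ) * (2 * Real.pi) := by
    rw [harg, Int.fract]
    push_cast
    linear_combination (Real.pi / 5) * hcast
  rw [this]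
  push_cast
  ring

end LinearTrajectory

end DoublePentagon

open DoublePentagon in
theorem mainTheorem8 (τ : LinearTrajectory) (n : ℕ) (hn : 0 < n)
    (hper : Function.Periodic τ.cuttingSequence (n : ℤ)) :
    -- any direction: a period read from any place, as a cyclic word
    (∀ m : ℤ, (reverseSwap (τ.block m n)).IsRotated (τ.block m n) ∧
      (flatten (τ.block m n)).reverse.IsRotated (flatten (τ.block m n))) ∧
    -- any direction: a period read from a suitable place
    (∃ m : ℤ, PalindromeProperties (τ.block m n)) ∧
    -- directions in the sector `[0, π / 5)`: the place given by the substitutions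
    (0 ≤ τ.dir.arg → τ.dir.arg < Real.pi / 5 →
      (∃ s ∈ startingWords, ∃ (ks : List (Fin 4)) (m : ℤ), τ.ReadsAs m (applyRules ks s)) ∧
      (∀ s ∈ startingWords, ∀ (ks : List (Fin 4)) (m : ℤ), τ.ReadsAs m (applyRules ks s) →
        PalindromeProperties (applyRules ks s) ∧ PalindromeProperties (τ.block m n))) := by
  have hper' : Function.Periodic τ.label (n : ℤ) := hper
  obtain ⟨m₀, hm₀⟩ := τ.exists_symmetricAt hn hper'
  refine ⟨fun m => ⟨hm₀.isRotated hper' m, ?_⟩, ⟨m₀, hm₀.palindromeProperties hper'⟩,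
    fun h0 h1 => ⟨?_, fun s hs ks m hm => ?_⟩⟩
  · rw [← flatten_reverseSwap]
    exact isRotated_flatMap _ (hm₀.isRotated hper' m)
  · obtain ⟨ha, hb⟩ := widths_of_angle (norm_pos_iff.2 τ.dir_ne_zero) h0 h1
      (Complex.norm_mul_exp_arg_mul_I τ.dir).symm
    exact τ.exists_readsAs_applyRules ha hb hn hper'
  · have hsym := hm.symmetricAt (reverseSwap_applyRules hs ks)
    refine ⟨?_, hsym.palindromeProperties hper'⟩
    have := hsym.palindromeProperties hm.periodic
    rwa [hm.block_eq] at this
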